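/- Let $\Phi$ be a stationary simple point process on $\mathbb{R}^2$ (a random locally finite set of points whose law is invariant under translations), defined on a probability space $(\Omega,\mathcal{A},\mathbb{P})$, and let $H>0$. Suppose that $\Phi$ is $H$-hardcore regulated: almost surely, any two distinct points of $\Phi$ are at Euclidean distance at least $2H$. Let $\ell\colon[0,\infty)\to[0,\infty)$ be a (bounded, non-negative) non-increasing function. Then, $\mathbb{P}$-almost surely, the following holds for every point $x_0\in\Phi$ nearest to the origin, i.e. $x_0\in\operatorname{argmin}\{\|x\| : x\in\Phi\}$. Put $d=\|x_0\|$ and $t=\max(d,\,2H-d)$, and let $b(o,R)$ be the open ball of radius $R$ centred at the origin $o$. Then for all $R\ge t$, $$\sum_{x\in\Phi\cap b(o,R),\,x\neq x_0}\ell(\|x\|)\;\le\;\int_t^R \frac{2\pi\,\ell(r)}{\sqrt{12}}\left(\frac1H+\frac{r}{H^2}\right)\mathrm{d}r\;+\;\frac{\pi\,\ell(t)\,t}{\sqrt{12}}\left(\frac2H+\frac{t}{H^2}\right).$$ -/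

import Mathlib

open MeasureTheory Set

/-- The Euclidean plane `ℝ²`. -/
abbrev Plane : Type := EuclideanSpace ℝ (Fin 2)

/-- A point configuration in the plane: a locally finite set of points
(only finitely many points in every bounded set). -/
structure Configuration where
  carrier : Set Plane
  locallyFinite : ∀ B : Set Plane, Bornology.IsBounded B → (carrier ∩ B).Finite

namespace Configuration

/-- The number `S(B)` of points of the configuration `S` in the set `B`. -/
noncomputable def count (B : Set Plane) (S : Configuration) : ℕ∞ :=
  (S.carrier ∩ B).encard

/-- The σ-algebra on configurations generated by the counting maps `S ↦ S(B)`, `B` Borel. -/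
noncomputable instance : MeasurableSpace Configuration :=
  ⨆ B : {B : Set Plane // MeasurableSet B}, MeasurableSpace.comap (count B.1) ⊤

theorem measurable_count {B : Set Plane} (hB : MeasurableSet B) :
    @Measurable Configuration ℕ∞ _ ⊤ (count B) := by
  rw [measurable_iff_comap_le]
  exact le_iSup (fun B : {B : Set Plane // MeasurableSet B} =>
    MeasurableSpace.comap (count B.1) ⊤) ⟨B, hB⟩

/-- The configuration `S + v`. -/
def translate (v : Plane) (S : Configuration) : Configuration where
  carrier := (fun x => x + v) '' S.carrier
  locallyFinite := by
    intro B hB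
    have h : ((fun x => x + v) ⁻¹' B) = (fun x => x + (-v)) '' B := by
      ext x
      constructor
      · intro hx
        exact ⟨x + v, hx, by simp⟩
      · rintro ⟨y, hy, rfl⟩
        simpa using hy
    have hb : Bornology.IsBounded ((fun x => x + v) ⁻¹' B) := by
      rw [h]
      exact ((isometry_add_right (-v)).lipschitz).isBounded_image hB
    rw [← image_inter_preimage]
    exact (S.locallyFinite _ hb).image _

theorem count_translate (v : Plane) (B : Set Plane) (S : Configuration) :
    count B (translate v S) = count ((fun x => x + v) ⁻¹' B) S := by
  unfold count translate
  rw [← image_inter_preimage]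
  exact (add_left_injective v).encard_image _

theorem measurable_translate (v : Plane) : Measurable (translate v) := by
  rw [measurable_iff_comap_le]
  change MeasurableSpace.comap (translate v) (⨆ B : {B : Set Plane // MeasurableSet B},
    MeasurableSpace.comap (count B.1) ⊤) ≤ _
  rw [MeasurableSpace.comap_iSup]
  refine iSup_le fun B => ?_
  rw [MeasurableSpace.comap_comp]
  have h : count B.1 ∘ translate v = count ((fun x => x + v) ⁻¹' B.1) :=
    funext fun S => count_translate v B.1 S
  rw [h]
  exact (measurable_iff_comap_le).1 (measurable_count (B.2.preimage (measurable_add_const v)))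

theorem finite_interferers (S : Configuration) (x₀ : Plane) (R : ℝ) :
    ((S.carrier ∩ Metric.ball 0 R) \ {x₀}).Finite :=
  (S.locallyFinite _ Metric.isBounded_ball).sdiff

/-- `x₀` is a point of `S` nearest to the origin, i.e. `x₀ ∈ argmin {‖x‖ : x ∈ S}`. -/
def IsNearest (S : Configuration) (x₀ : Plane) : Prop :=
  x₀ ∈ S.carrier ∧ ∀ x ∈ S.carrier, ‖x₀‖ ≤ ‖x‖

/-- The interference `∑ ℓ(‖x‖)` at the origin, over the points `x ≠ x₀` of `S` in the open
ball `b(o, R)`. -/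
noncomputable def interference (ℓ : ℝ → ℝ) (S : Configuration) (x₀ : Plane) (R : ℝ) : ℝ :=
  ∑ x ∈ (S.finite_interferers x₀ R).toFinset, ℓ ‖x‖

end Configuration

/-- `Φ` is a stationary (simple) point process on the plane: a random locally finite set of
points whose law is invariant under all translations. -/
structure IsStationaryPointProcess {Ω : Type*} [MeasurableSpace Ω] (P : Measure Ω)
    (Φ : Ω → Configuration) : Prop where
  measurable : Measurable Φ
  stationary : ∀ v : Plane, P.map (fun ω => (Φ ω).translate v) = P.map Φ

/-- Almost surely, any two distinct points of `Φ` are at distance at least `2H`. -/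
def IsHardcoreRegulated {Ω : Type*} [MeasurableSpace Ω] (P : Measure Ω) (H : ℝ)
    (Φ : Ω → Configuration) : Prop :=
  ∀ᵐ ω ∂P, ∀ x ∈ (Φ ω).carrier, ∀ y ∈ (Φ ω).carrier, x ≠ y → 2 * H ≤ ‖x - y‖

/-!
The estimate is deterministic. Let `G r = π / √12 * (2 r / H + r ^ 2 / H ^ 2)`. If `x₀` is a
nearest point of a `2H`-separated configuration, every other point has norm at least `t = max d (2H - d)`,
and the heart of the matter is that at most `G r` points other than `x₀` have norm at most `r`
(`card_le_of_separated`). Since the right-hand side of the claim is the integral of `ℓ G'` over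
`[t, R]` plus `ℓ t * G t`, the sum is then bounded by a summation by parts (`sum_antitone_le`): sorting the points by
norm, each new point of norm `s` is paid for by a unit of `G s`, and `ℓ` is non-increasing.

The counting bound is a finite version of Thue's theorem with an explicit boundary term. Scale to
`H = 1`, let the points lie in the disc of radius `r`, and put `q = r + 1`, `ρ = 2 / √3`. Truncate
the Voronoi cell of each point `x` by the disc of radius `ρ` about `x` and by the tangent line of the
circle of radius `q` in the direction of `x`. That line is the bisector of `x` and its mirror image,
which is at distance at least `2` from all the points, so it behaves like the bisector with one more
neighbour. Each truncated cell has area at least `√12 = 2√3`, the area of the hexagon circumscribed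
about the unit circle (`volume_truncatedCell_ge`): the caps which the bisectors cut from the disc of
radius `ρ` span disjoint sectors of half-angle at most `π / 6`, and such a cap takes up at most the
fraction `1 - 3√3 / (2π)` of its sector (`volume_cap_le`).

If `r < 1` there is at most one point. If `r ≥ 1`, the truncated cells are disjoint and lie in the
disc of radius `q`, except for slivers between the circle and its tangent lines. Only points of norm close to `r` have a sliver; there are at most
`π r / 0.99` of them (`card_boundary_le`), each sliver has area of order `1 / r` (`volume_sliver_le`),
and the total is at most `2√3 - π` (`boundary_estimate`). Hence
`N * 2√3 ≤ π q ^ 2 + (2√3 - π)`, which says `N ≤ 1 + G r`.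
-/

/-! ### Coordinates adapted to a direction -/

/-- Measure-preserving Cartesian coordinates on the plane whose first axis points along `u`. -/
theorem exists_measurePreserving_frame {u : Plane} (hu : u ≠ 0) :
    ∃ e : ℝ × ℝ ≃ᵐ Plane, MeasurePreserving e volume volume ∧
      (∀ p, ‖e p‖ ^ 2 = p.1 ^ 2 + p.2 ^ 2) ∧ ∀ p, inner ℝ (e p) u = p.1 * ‖u‖ := by
  have hn : ‖u‖ ≠ 0 := norm_ne_zero_iff.2 hu
  have hn2 : u 0 ^ 2 + u 1 ^ 2 = ‖u‖ ^ 2 := by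
    rw [EuclideanSpace.norm_sq_eq]; simp
  set w : Plane := !₂[-u 1, u 0] with hw
  have hwn : ‖w‖ = ‖u‖ := by
    rw [← sq_eq_sq₀ (norm_nonneg _) (norm_nonneg _), ← hn2, EuclideanSpace.norm_sq_eq]
    simp [hw]; ring
  have huw : inner ℝ u w = 0 := by
    simp [hw, PiLp.inner_apply]; ring
  have hon : Orthonormal ℝ ![‖u‖⁻¹ • u, ‖u‖⁻¹ • w] := by
    constructor
    · intro i
      fin_cases i <;> simp [norm_smul, hwn, hn]
    · intro i j hij
      fin_cases i <;> fin_cases j <;> simp_all [inner_smul_left, inner_smul_right, real_inner_comm]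
  have hc : Fintype.card (Fin 2) = Module.finrank ℝ Plane := by simp
  let b : OrthonormalBasis (Fin 2) ℝ Plane :=
    (basisOfOrthonormalOfCardEqFinrank hon hc).toOrthonormalBasis
      (by rw [coe_basisOfOrthonormalOfCardEqFinrank]; exact hon)
  have hb0 : b 0 = ‖u‖⁻¹ • u := by
    simp [b]
  let e₁ : ℝ × ℝ ≃ᵐ (Fin 2 → ℝ) := (MeasurableEquiv.finTwoArrow (α := ℝ)).symm
  let e₂ : (Fin 2 → ℝ) ≃ᵐ Plane := MeasurableEquiv.toLp 2 (Fin 2 → ℝ)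
  let e₃ : Plane ≃ᵐ Plane := b.repr.symm.toHomeomorph.toMeasurableEquiv
  have h₁ : MeasurePreserving e₁ volume volume := (volume_preserving_finTwoArrow ℝ).symm
  have h₂ : MeasurePreserving e₂ volume volume :=
    (EuclideanSpace.volume_preserving_symm_measurableEquiv_toLp (Fin 2)).symm
  have h₃ : MeasurePreserving e₃ volume volume := b.measurePreserving_repr_symm
  have hrep : ∀ p : ℝ × ℝ, b.repr (e₃ (e₂ (e₁ p))) = !₂[p.1, p.2] := by
    intro p
    change b.repr (b.repr.symm (e₂ (e₁ p))) = _
    rw [LinearIsometryEquiv.apply_symm_apply]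
    rfl
  refine ⟨e₁.trans (e₂.trans e₃), (h₃.comp h₂).comp h₁, fun p => ?_, fun p => ?_⟩
  · change ‖e₃ (e₂ (e₁ p))‖ ^ 2 = _
    rw [← b.repr.norm_map, hrep, EuclideanSpace.norm_sq_eq]
    simp
  · change inner ℝ (e₃ (e₂ (e₁ p))) u = _
    have h := b.repr_apply_apply (e₃ (e₂ (e₁ p))) 0
    rw [hrep, hb0, inner_smul_left, real_inner_comm] at h
    simp at h
    rw [h]; field_simp

/-! ### Areas of sectors and caps -/

/-- The open circular sector of radius `ρ` and half-angle `α` about the direction of `u`, with apex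
at the origin. The angular condition is written as an inequality for inner products, so that no
choice of an angle is needed; it excludes the apex. -/
def sector (ρ α : ℝ) (u : Plane) : Set Plane :=
  {y | ‖y‖ < ρ ∧ Real.cos α * (‖y‖ * ‖u‖) < inner ℝ y u}

theorem measurableSet_sector (ρ α : ℝ) (u : Plane) : MeasurableSet (sector ρ α u) := by
  have h₁ : MeasurableSet {y : Plane | ‖y‖ < ρ} := measurableSet_lt (by fun_prop) (by fun_prop)
  have h₂ : MeasurableSet {y : Plane | Real.cos α * (‖y‖ * ‖u‖) < inner ℝ y u} :=
    measurableSet_lt (by fun_prop) (by fun_prop)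
  exact h₁.inter h₂

theorem norm_eq_sqrt_of_sq {p : ℝ × ℝ} {y : Plane} (h : ‖y‖ ^ 2 = p.1 ^ 2 + p.2 ^ 2) :
    ‖y‖ = √(p.1 ^ 2 + p.2 ^ 2) := by
  rw [← h, Real.sqrt_sq (norm_nonneg _)]

/-- The sector in coordinates; polar coordinates turn it into the rectangle
`(0, ρ) × (-α, α)`. -/
theorem volume_polar_sector {ρ α : ℝ} (hρ : 0 < ρ) (hα : 0 < α) (hαπ : α ≤ Real.pi) :
    volume {p : ℝ × ℝ | √(p.1 ^ 2 + p.2 ^ 2) < ρ ∧ Real.cos α * √(p.1 ^ 2 + p.2 ^ 2) < p.1} =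
      ENNReal.ofReal (ρ ^ 2 * α) := by
  set s := {p : ℝ × ℝ | √(p.1 ^ 2 + p.2 ^ 2) < ρ ∧ Real.cos α * √(p.1 ^ 2 + p.2 ^ 2) < p.1}
  have hs : MeasurableSet s := by
    have h₁ : MeasurableSet {p : ℝ × ℝ | √(p.1 ^ 2 + p.2 ^ 2) < ρ} :=
      measurableSet_lt (by fun_prop) (by fun_prop)
    have h₂ : MeasurableSet {p : ℝ × ℝ | Real.cos α * √(p.1 ^ 2 + p.2 ^ 2) < p.1} :=
      measurableSet_lt (by fun_prop) (by fun_prop)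
    exact h₁.inter h₂
  have ht : MeasurableSet (Ioo 0 ρ ×ˢ Ioo (-α) α) := measurableSet_Ioo.prod measurableSet_Ioo
  rw [← lintegral_indicator_one hs, ← lintegral_comp_polarCoord_symm]
  have key : ∀ p ∈ polarCoord.target, ENNReal.ofReal p.1 • s.indicator 1 (polarCoord.symm p) =
      (Ioo 0 ρ ×ˢ Ioo (-α) α).indicator (fun p => ENNReal.ofReal p.1) p := by
    rintro ⟨r, θ⟩ hp
    rw [polarCoord_target] at hp
    obtain ⟨hr, hθ1, hθ2⟩ := hp
    simp only [mem_Ioi] at hr hθ1 hθ2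
    have hsq : √((r * Real.cos θ) ^ 2 + (r * Real.sin θ) ^ 2) = r := by
      rw [show (r * Real.cos θ) ^ 2 + (r * Real.sin θ) ^ 2 = r ^ 2 by
        linear_combination r ^ 2 * Real.cos_sq_add_sin_sq θ, Real.sqrt_sq hr.le]
    have hiff : polarCoord.symm (r, θ) ∈ s ↔ (r, θ) ∈ Ioo 0 ρ ×ˢ Ioo (-α) α := by
      simp only [polarCoord_symm_apply, s, mem_ofPred_eq, hsq, mem_prod, mem_Ioo]
      rw [mul_comm r, mul_lt_mul_iff_left₀ hr, ← abs_lt, ← Real.cos_abs θ,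
        Real.strictAntiOn_cos.lt_iff_gt ⟨hα.le, hαπ⟩ ⟨abs_nonneg _, (abs_lt.2 ⟨hθ1, hθ2⟩).le⟩]
      simp [hr]
    by_cases h : (r, θ) ∈ Ioo 0 ρ ×ˢ Ioo (-α) α
    · rw [indicator_of_mem h, indicator_of_mem (hiff.2 h)]; simp
    · rw [indicator_of_notMem h, indicator_of_notMem (fun h' => h (hiff.1 h'))]; simp
  have hT : MeasurableSet polarCoord.target := polarCoord.open_target.measurableSet
  rw [setLIntegral_congr_fun hT key, lintegral_indicator ht, Measure.restrict_restrict ht,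
    inter_eq_left.2]
  · rw [Measure.volume_eq_prod, ← Measure.prod_restrict,
      lintegral_prod _ (by fun_prop)]
    simp only [lintegral_const, Measure.restrict_apply MeasurableSet.univ, univ_inter,
      Real.volume_Ioo]
    rw [lintegral_mul_const _ (by fun_prop),
      ← ofReal_integral_eq_lintegral_ofReal, ← ENNReal.ofReal_mul]
    · congr 1
      rw [← integral_Ioc_eq_integral_Ioo, ← intervalIntegral.integral_of_le hρ.le, integral_id]
      ring
    · exact setIntegral_nonneg measurableSet_Ioo fun x hx => hx.1.le
    · exact (continuous_id.integrableOn_Icc).mono_set Ioo_subset_Icc_self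
    · exact (ae_restrict_mem measurableSet_Ioo).mono fun x hx => hx.1.le
  · rw [polarCoord_target]
    exact prod_mono (fun x hx => hx.1) (Ioo_subset_Ioo (by linarith) hαπ)

theorem volume_real_sector {ρ α : ℝ} (hρ : 0 < ρ) (hα : 0 < α) (hαπ : α ≤ Real.pi) {u : Plane}
    (hu : u ≠ 0) : volume.real (sector ρ α u) = ρ ^ 2 * α := by
  obtain ⟨e, he, hen, hei⟩ := exists_measurePreserving_frame hu
  rw [measureReal_def, ← he.measure_preimage_equiv]
  have : e ⁻¹' sector ρ α u =
      {p : ℝ × ℝ | √(p.1 ^ 2 + p.2 ^ 2) < ρ ∧ Real.cos α * √(p.1 ^ 2 + p.2 ^ 2) < p.1} := by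
    ext p
    simp only [sector, mem_preimage, mem_ofPred_eq, norm_eq_sqrt_of_sq (hen p), hei]
    rw [← mul_assoc, mul_lt_mul_iff_left₀ (norm_pos_iff.2 hu)]
  rw [this, volume_polar_sector hρ hα hαπ, ENNReal.toReal_ofReal (by positivity)]

/-- The isosceles triangle with apex at the origin, height `h` and half-base `τ * h`. -/
theorem volume_triangle {h τ : ℝ} (hh : 0 ≤ h) (hτ : 0 ≤ τ) :
    volume (regionBetween (fun x => -(τ * x)) (fun x => τ * x) (Ioo 0 h)) =
      ENNReal.ofReal (τ * h ^ 2) := by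
  rw [Measure.volume_eq_prod, volume_regionBetween_eq_integral]
  · congr 1
    rw [← integral_Ioc_eq_integral_Ioo, ← intervalIntegral.integral_of_le hh]
    simp only [Pi.sub_apply, sub_neg_eq_add, ← two_mul]
    rw [intervalIntegral.integral_const_mul, intervalIntegral.integral_const_mul, integral_id]
    ring
  · exact ((by fun_prop : Continuous fun x : ℝ => -(τ * x)).integrableOn_Icc).mono_set
      Ioo_subset_Icc_self
  · exact ((by fun_prop : Continuous fun x : ℝ => (τ * x)).integrableOn_Icc).mono_set
      Ioo_subset_Icc_self
  · exact measurableSet_Ioo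
  · intro x hx
    have : 0 ≤ τ * x := mul_nonneg hτ hx.1.le
    linarith

/-- The cap that the line orthogonal to `u` at distance `ρ * cos α` from the origin cuts from the
open disc of radius `ρ`. Seen from the centre it has half-angle `α`. -/
def cap (ρ α : ℝ) (u : Plane) : Set Plane :=
  {y | ‖y‖ < ρ ∧ ρ * Real.cos α * ‖u‖ ≤ inner ℝ y u}

theorem measurableSet_cap (ρ α : ℝ) (u : Plane) : MeasurableSet (cap ρ α u) := by
  have h₁ : MeasurableSet {y : Plane | ‖y‖ < ρ} := measurableSet_lt (by fun_prop) (by fun_prop)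
  have h₂ : MeasurableSet {y : Plane | ρ * Real.cos α * ‖u‖ ≤ inner ℝ y u} :=
    measurableSet_le (by fun_prop) (by fun_prop)
  exact h₁.inter h₂

theorem volume_ne_top_of_subset_ball {s : Set Plane} {ρ : ℝ} (h : ∀ y ∈ s, ‖y‖ < ρ) :
    volume s ≠ ⊤ :=
  ((measure_mono (fun y hy => by simpa using h y hy : s ⊆ Metric.ball 0 ρ)).trans_lt
    measure_ball_lt_top).ne

theorem cap_subset_sector {ρ α : ℝ} (hα : 0 < Real.cos α) {u : Plane} (hu : u ≠ 0) :
    cap ρ α u ⊆ sector ρ α u := by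
  rintro y ⟨hy, hyu⟩
  refine ⟨hy, lt_of_lt_of_le ?_ hyu⟩
  have := norm_pos_iff.2 hu
  rw [mul_comm ρ, mul_assoc]
  gcongr

/-- A sector without its cap is an isosceles triangle with two sides of length `ρ` enclosing
the angle `2 α`. -/
theorem volume_sector_diff_cap_ge {ρ α : ℝ} (hρ : 0 < ρ) (hα : 0 < α) (hα' : α < Real.pi / 2)
    {u : Plane} (hu : u ≠ 0) :
    ρ ^ 2 * (Real.sin α * Real.cos α) ≤ volume.real (sector ρ α u \ cap ρ α u) := by
  obtain ⟨e, he, hen, hei⟩ := exists_measurePreserving_frame hu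
  have hc : 0 < Real.cos α := Real.cos_pos_of_mem_Ioo ⟨by linarith, hα'⟩
  have hsin : 0 < Real.sin α := Real.sin_pos_of_pos_of_lt_pi hα (by linarith)
  have hfin : volume (sector ρ α u \ cap ρ α u) ≠ ⊤ :=
    volume_ne_top_of_subset_ball (ρ := ρ) fun y hy => hy.1.1
  have hle : volume (regionBetween (fun x => -(Real.tan α * x)) (fun x => Real.tan α * x)
      (Ioo 0 (ρ * Real.cos α))) ≤ volume (e ⁻¹' (sector ρ α u \ cap ρ α u)) := by
    apply measure_mono
    rintro p ⟨⟨hp0, hp1⟩, hp2, hp3⟩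
    have habs : |p.2| < Real.tan α * p.1 := abs_lt.2 ⟨hp2, hp3⟩
    have hsq : (Real.cos α * p.2) ^ 2 < (Real.sin α * p.1) ^ 2 := by
      rw [sq_lt_sq, abs_mul, abs_of_pos hc, abs_of_pos (mul_pos hsin hp0)]
      rw [Real.tan_eq_sin_div_cos] at habs
      calc Real.cos α * |p.2| < Real.cos α * (Real.sin α / Real.cos α * p.1) := by gcongr
        _ = _ := by field_simp
    have hlt : Real.cos α * ‖e p‖ < p.1 := by
      refine lt_of_pow_lt_pow_left₀ 2 hp0.le ?_
      rw [mul_pow, hen]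
      have := Real.sin_sq_add_cos_sq α
      nlinarith
    have hun := norm_pos_iff.2 hu
    refine ⟨⟨?_, ?_⟩, fun h => ?_⟩
    · nlinarith
    · rw [hei, ← mul_assoc]; gcongr
    · have h2 := h.2
      rw [hei] at h2
      have := le_of_mul_le_mul_right h2 hun
      linarith
  rw [volume_triangle (by positivity) (Real.tan_pos_of_pos_of_lt_pi_div_two hα hα').le,
    he.measure_preimage_equiv] at hle
  rw [measureReal_def, ← ENNReal.ofReal_le_iff_le_toReal hfin]
  convert hle using 2
  rw [Real.tan_eq_sin_div_cos]
  field_simp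

/-- Concavity of `sin` on `[0, π / 3]`, at the point `2 α`. -/
theorem sin_mul_cos_ge {α : ℝ} (hα : 0 ≤ α) (hα' : α ≤ Real.pi / 6) :
    3 * √3 / (2 * Real.pi) * α ≤ Real.sin α * Real.cos α := by
  have hπ := Real.pi_pos
  have h := strictConcaveOn_sin_Icc.concaveOn.2 (⟨le_rfl, hπ.le⟩ : (0 : ℝ) ∈ Icc 0 Real.pi)
    (⟨by positivity, by linarith⟩ : Real.pi / 3 ∈ Icc 0 Real.pi)
    (by rw [sub_nonneg, div_le_one hπ]; linarith : 0 ≤ 1 - 6 * α / Real.pi)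
    (by positivity : 0 ≤ 6 * α / Real.pi) (by ring)
  simp only [smul_eq_mul, mul_zero, zero_add, Real.sin_zero, Real.sin_pi_div_three] at h
  rw [show 6 * α / Real.pi * (Real.pi / 3) = 2 * α by field_simp; ring, Real.sin_two_mul] at h
  calc 3 * √3 / (2 * Real.pi) * α = (6 * α / Real.pi * (√3 / 2)) / 2 := by field_simp; ring
    _ ≤ _ := by linarith

/-- Among caps of half-angle at most `π / 6`, the fraction of the sector taken up by the cap is
largest at `π / 6`. -/
theorem volume_cap_le {ρ α : ℝ} (hρ : 0 < ρ) (hα : 0 < α) (hα' : α ≤ Real.pi / 6)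
    {u : Plane} (hu : u ≠ 0) :
    volume.real (cap ρ α u) ≤ (1 - 3 * √3 / (2 * Real.pi)) * volume.real (sector ρ α u) := by
  have hπ := Real.pi_pos
  have hc : 0 < Real.cos α := Real.cos_pos_of_mem_Ioo ⟨by linarith, by linarith⟩
  have h1 := volume_sector_diff_cap_ge hρ hα (by linarith) hu
  rw [measureReal_sdiff (cap_subset_sector hc hu) (measurableSet_cap _ _ _)
    (volume_ne_top_of_subset_ball (ρ := ρ) fun y hy => hy.1)] at h1
  have h2 := mul_le_mul_of_nonneg_left (sin_mul_cos_ge hα.le hα') (sq_nonneg ρ)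
  have h3 := volume_real_sector hρ hα (by linarith) hu
  rw [h3] at h1 ⊢
  linarith

/-- Sectors about `u` and `v` of half-angles `α` and `β` are disjoint as soon as the angle between
`u` and `v` is at least `α + β`. -/
theorem disjoint_sector {ρ α β : ℝ} (hα : 0 ≤ α) (hβ : 0 ≤ β) (hαβ : α + β ≤ Real.pi)
    {u v : Plane} (h : inner ℝ u v ≤ Real.cos (α + β) * (‖u‖ * ‖v‖)) (hu : u ≠ 0) (hv : v ≠ 0) :
    Disjoint (sector ρ α u) (sector ρ β v) := by
  have aux : ∀ {w y : Plane} {γ : ℝ}, w ≠ 0 → 0 ≤ γ → γ ≤ Real.pi → y ∈ sector ρ γ w →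
      InnerProductGeometry.angle y w < γ := by
    intro w y γ hw hγ hγ' hy
    by_contra! hle
    have h1 := hy.2
    rw [← InnerProductGeometry.cos_angle_mul_norm_mul_norm] at h1
    have h2 := Real.cos_le_cos_of_nonneg_of_le_pi hγ (InnerProductGeometry.angle_le_pi y w) hle
    have h3 : 0 ≤ ‖y‖ * ‖w‖ := by positivity
    exact absurd h1 (not_lt.2 (mul_le_mul_of_nonneg_right h2 h3))
  rw [Set.disjoint_left]
  intro y hyu hyv
  have h1 := aux hu hα (by linarith) hyu
  have h2 := aux hv hβ (by linarith) hyv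
  have h3 := InnerProductGeometry.angle_le_angle_add_angle u y v
  rw [InnerProductGeometry.angle_comm u y] at h3
  have h4 := Real.cos_lt_cos_of_nonneg_of_le_pi (InnerProductGeometry.angle_nonneg u v) hαβ
    (by linarith)
  rw [← InnerProductGeometry.cos_angle_mul_norm_mul_norm] at h
  have h5 : 0 < ‖u‖ * ‖v‖ := mul_pos (norm_pos_iff.2 hu) (norm_pos_iff.2 hv)
  exact absurd (le_of_mul_le_mul_right h h5) (not_le.2 h4)

/-- The circumradius `2 / √3` of a regular hexagon whose incircle has radius `1`. -/
noncomputable def hexRadius : ℝ := 2 / √3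

theorem hexRadius_pos : 0 < hexRadius := by unfold hexRadius; positivity

theorem hexRadius_sq : hexRadius ^ 2 = 4 / 3 := by
  rw [hexRadius, div_pow, Real.sq_sqrt (by norm_num)]; norm_num

theorem hexRadius_lt : hexRadius < 1.16 :=
  lt_of_pow_lt_pow_left₀ 2 (by norm_num) (by rw [hexRadius_sq]; norm_num)

theorem volume_real_ball (x : Plane) {ρ : ℝ} (hρ : 0 ≤ ρ) :
    volume.real (Metric.ball x ρ) = Real.pi * ρ ^ 2 := by
  rw [measureReal_def, EuclideanSpace.volume_ball_fin_two, ENNReal.toReal_mul, ENNReal.toReal_pow,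
    ENNReal.toReal_ofReal hρ, ENNReal.toReal_ofReal Real.pi_pos.le, mul_comm]

/-- The trigonometric form of a disjointness criterion: if two points at distances
`2 ρ cos α` and `2 ρ cos β` from the origin, where `ρ = 2 / √3`, are at distance at least `2`, then
they are seen from the origin under an angle of at least `α + β`. -/
theorem cos_sq_add_cos_sq_le {α β : ℝ} (hα : 0 ≤ α) (hβ : 0 ≤ β) (h : α + β ≤ Real.pi / 3) :
    Real.cos α ^ 2 + Real.cos β ^ 2 - 3 / 4 ≤
      2 * Real.cos α * Real.cos β * Real.cos (α + β) := by
  have hπ := Real.pi_pos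
  have hC : 1 / 2 ≤ Real.cos (α + β) := by
    rw [← Real.cos_pi_div_three]
    exact Real.cos_le_cos_of_nonneg_of_le_pi (by positivity) (by linarith) h
  -- The law of cosines in a triangle of circumdiameter `1` with angles `π / 2 - α`, `π / 2 - β`
  -- and `α + β`.
  have key : Real.cos α ^ 2 + Real.cos β ^ 2 - 2 * Real.cos α * Real.cos β * Real.cos (α + β)
      = 1 - Real.cos (α + β) ^ 2 := by
    rw [Real.cos_add]
    linear_combination Real.sin α ^ 2 * Real.sin_sq_add_cos_sq β
      + (1 - Real.cos β ^ 2) * Real.sin_sq_add_cos_sq α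
  nlinarith

/-- The Voronoi cell of the origin with respect to the neighbours `V`, truncated by the open disc of
radius `hexRadius`. The strict inequalities make cells of different points disjoint. -/
def truncatedCell (V : Finset Plane) : Set Plane :=
  {y | ‖y‖ < hexRadius ∧ ∀ v ∈ V, inner ℝ y v < ‖v‖ ^ 2 / 2}

/-- A truncated Voronoi cell in a `2`-separated configuration is at least as large as the regular
hexagon circumscribed about the unit circle. -/
theorem volume_truncatedCell_ge (V : Finset Plane) (hV : ∀ v ∈ V, 2 ≤ ‖v‖)
    (hVV : ∀ v ∈ V, ∀ w ∈ V, v ≠ w → 2 ≤ ‖v - w‖) :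
    2 * √3 ≤ volume.real (truncatedCell V) := by
  classical
  have hπ := Real.pi_pos
  have hρ := hexRadius_pos
  have hρ2 := hexRadius_sq
  -- Only neighbours closer than `2 * hexRadius` cut anything from the disc; `α v` is the half-angle
  -- of the cap cut by the bisector with `v`.
  set W := V.filter (fun v => ‖v‖ < 2 * hexRadius) with hW
  set α : Plane → ℝ := fun v => Real.arccos (‖v‖ / (2 * hexRadius)) with hαdef
  have hWV : ∀ v ∈ W, v ∈ V := fun v hv => (Finset.mem_filter.1 hv).1
  have hlt : ∀ v ∈ W, ‖v‖ < 2 * hexRadius := fun v hv => (Finset.mem_filter.1 hv).2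
  have h0 : ∀ v ∈ W, v ≠ 0 := fun v hv h => by
    have := hV v (hWV v hv); rw [h, norm_zero] at this; linarith
  have hcos : ∀ v ∈ W, 2 * hexRadius * Real.cos (α v) = ‖v‖ := by
    intro v hv
    rw [hαdef]
    simp only
    rw [Real.cos_arccos]
    · field_simp
    · exact le_trans (by norm_num) (by positivity : 0 ≤ ‖v‖ / (2 * hexRadius))
    · rw [div_le_one (by positivity)]; exact (hlt v hv).le
  have hα0 : ∀ v ∈ W, 0 < α v := fun v hv => by
    rw [Real.arccos_pos, div_lt_one (by positivity)]; exact hlt v hv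
  have hα6 : ∀ v ∈ W, α v ≤ Real.pi / 6 := fun v hv => by
    by_contra! h
    have h1 := Real.cos_lt_cos_of_nonneg_of_le_pi (by positivity) (Real.arccos_le_pi _) h
    have h2 := hcos v hv
    rw [Real.cos_pi_div_six] at h1
    have h3 : 2 * hexRadius * Real.cos (α v) < 2 * hexRadius * (√3 / 2) := by gcongr
    have h4 : 2 * hexRadius * (√3 / 2) = 2 := by unfold hexRadius; field_simp
    have h5 := hV v (hWV v hv)
    linarith
  have hdisj : (W : Set Plane).PairwiseDisjoint fun v => sector hexRadius (α v) v := by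
    intro v hv w hw hvw
    have hv := Finset.mem_coe.1 hv
    have hw := Finset.mem_coe.1 hw
    refine disjoint_sector (hα0 v hv).le (hα0 w hw).le ?_ ?_ (h0 v hv) (h0 w hw)
    · linarith [hα6 v hv, hα6 w hw]
    · have h1 := norm_sub_sq_real v w
      have h2 := hVV v (hWV v hv) w (hWV w hw) hvw
      have h3 := cos_sq_add_cos_sq_le (hα0 v hv).le (hα0 w hw).le
        (by linarith [hα6 v hv, hα6 w hw])
      have h4 : 4 ≤ ‖v - w‖ ^ 2 := by nlinarith
      rw [← hcos v hv, ← hcos w hw] at h1 ⊢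
      have h5 : (2 * hexRadius * Real.cos (α v)) ^ 2 = 16 / 3 * Real.cos (α v) ^ 2 := by
        linear_combination 4 * Real.cos (α v) ^ 2 * hρ2
      have h6 : (2 * hexRadius * Real.cos (α w)) ^ 2 = 16 / 3 * Real.cos (α w) ^ 2 := by
        linear_combination 4 * Real.cos (α w) ^ 2 * hρ2
      rw [h5, h6] at h1
      have h7 : Real.cos (α v + α w) * (2 * hexRadius * Real.cos (α v) *
          (2 * hexRadius * Real.cos (α w))) =
          8 / 3 * (2 * Real.cos (α v) * Real.cos (α w) * Real.cos (α v + α w)) := by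
        linear_combination 4 * Real.cos (α v) * Real.cos (α w) * Real.cos (α v + α w) * hρ2
      rw [h7]
      linarith
  have hcover : Metric.ball (0 : Plane) hexRadius ⊆
      truncatedCell V ∪ ⋃ v ∈ W, cap hexRadius (α v) v := by
    intro y hy
    rw [mem_ball_zero_iff] at hy
    by_cases h : ∀ v ∈ V, inner ℝ y v < ‖v‖ ^ 2 / 2
    · exact Or.inl ⟨hy, h⟩
    · right
      push Not at h
      obtain ⟨v, hv, hyv⟩ := h
      have hvpos : 0 < ‖v‖ := by linarith [hV v hv]
      have hvW : v ∈ W := by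
        rw [hW, Finset.mem_filter]
        refine ⟨hv, ?_⟩
        have h1 := real_inner_le_norm y v
        have h2 : ‖y‖ * ‖v‖ < hexRadius * ‖v‖ := by gcongr
        nlinarith
      refine mem_biUnion hvW ⟨hy, ?_⟩
      have := hcos v hvW
      calc hexRadius * Real.cos (α v) * ‖v‖
          = (2 * hexRadius * Real.cos (α v)) * ‖v‖ / 2 := by ring
        _ = ‖v‖ ^ 2 / 2 := by rw [this]; ring
        _ ≤ _ := hyv
  have hsum : ∑ v ∈ W, volume.real (sector hexRadius (α v) v) ≤ Real.pi * hexRadius ^ 2 := by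
    rw [← measureReal_biUnion_finset hdisj (fun v _ => measurableSet_sector _ _ _)
      (fun v _ => volume_ne_top_of_subset_ball (ρ := hexRadius) fun y hy => hy.1),
      ← volume_real_ball 0 hρ.le]
    refine measureReal_mono ?_ measure_ball_lt_top.ne
    refine iUnion₂_subset fun v _ y hy => ?_
    simpa using hy.1
  have hfin : volume (truncatedCell V ∪ ⋃ v ∈ W, cap hexRadius (α v) v) ≠ ⊤ := by
    refine volume_ne_top_of_subset_ball (ρ := hexRadius) ?_
    rintro y (hy | hy)
    · exact hy.1
    · obtain ⟨v, _, hy⟩ := mem_iUnion₂.1 hy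
      exact hy.1
  have hfinal : Real.pi * hexRadius ^ 2 ≤
      volume.real (truncatedCell V) + ∑ v ∈ W, volume.real (cap hexRadius (α v) v) := by
    rw [← volume_real_ball 0 hρ.le]
    refine (measureReal_mono hcover hfin).trans ((measureReal_union_le _ _).trans ?_)
    gcongr
    exact measureReal_biUnion_finset_le _ _
  have hcaps : ∑ v ∈ W, volume.real (cap hexRadius (α v) v) ≤
      (1 - 3 * √3 / (2 * Real.pi)) * ∑ v ∈ W, volume.real (sector hexRadius (α v) v) := by
    rw [Finset.mul_sum]
    exact Finset.sum_le_sum fun v hv => volume_cap_le hρ (hα0 v hv) (hα6 v hv) (h0 v hv)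
  have hc : 0 ≤ 1 - 3 * √3 / (2 * Real.pi) := by
    rw [sub_nonneg, div_le_one (by positivity)]
    have : √3 < 1.74 := by rw [Real.sqrt_lt' (by norm_num)]; norm_num
    linarith [Real.pi_gt_d2]
  have := mul_le_mul_of_nonneg_left hsum hc
  have h9 : Real.pi * hexRadius ^ 2 -
      (1 - 3 * √3 / (2 * Real.pi)) * (Real.pi * hexRadius ^ 2) = 2 * √3 := by
    rw [hρ2]; field_simp; ring
  linarith

/-! ### Slivers at the boundary -/

/-- The part of the disc of radius `hexRadius` about `x` that lies outside the circle of radius `q`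
about the origin, but on the inner side of its tangent line orthogonal to the unit vector `u`. -/
def sliver (q : ℝ) (x u : Plane) : Set Plane :=
  {y | ‖y - x‖ < hexRadius ∧ inner ℝ y u < q ∧ q < ‖y‖}

/-- In coordinates `(s, b)` with first axis through `x`, where `‖x‖ = a`, a sliver lies in the strip
`b ^ 2 < (r + 1) / (3 r)`, between the tangent line `s = r + 1` and a parabola. -/
theorem sliver_coordinates {r a s b : ℝ} (hr : 1 ≤ r) (ha : a ≤ r)
    (h1 : s ^ 2 + b ^ 2 - 2 * a * s + a ^ 2 < 4 / 3) (h2 : s < r + 1)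
    (h3 : (r + 1) ^ 2 < s ^ 2 + b ^ 2) (ha' : 0 < a) :
    b ^ 2 < (r + 1) / (3 * r) ∧ r + 1 - b ^ 2 / (2 * r + 11 / 6) < s := by
  have hs : r ≤ s := by
    by_contra! h
    nlinarith [mul_lt_mul_of_pos_left h ha', sq_nonneg (a - r)]
  -- As `r ≤ s`, moving the centre from `a` out to `r` only brings it closer to the point.
  have h1' : s ^ 2 + b ^ 2 - 2 * r * s + r ^ 2 < 4 / 3 := by
    nlinarith [mul_nonneg (sub_nonneg.2 ha) (by linarith : 0 ≤ 2 * s - (r + a))]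
  have h4 : r + 1 - 1 / (6 * r) < s := by
    have : r + 1 - 1 / (6 * r) = (2 * r ^ 2 + 2 * r - 1 / 3) / (2 * r) := by field_simp; ring
    rw [this, div_lt_iff₀ (by linarith)]
    nlinarith
  have h5 : 1 / (6 * r) ≤ 1 / 6 := by
    rw [div_le_div_iff₀ (by linarith) (by norm_num)]; linarith
  have h6 : 0 < 1 / (6 * r) := by positivity
  constructor
  · have h7 : (r + 1) / (3 * r) = 1 / 3 + 2 * (1 / (6 * r)) := by field_simp; ring
    rw [h7]
    nlinarith
  · have h8 : r + 1 - s < b ^ 2 / (2 * r + 11 / 6) := by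
      rw [lt_div_iff₀ (by linarith)]
      nlinarith
    linarith

theorem volume_sliver_le {r : ℝ} (hr : 1 ≤ r) {x u : Plane} (hu : ‖u‖ = 1) (hx : x = ‖x‖ • u)
    (hxr : ‖x‖ ≤ r) :
    volume.real (sliver (r + 1) x u) ≤
      2 / 3 * √((r + 1) / (3 * r)) ^ 3 / (2 * r + 11 / 6) := by
  have hu0 : u ≠ 0 := fun h => by simp [h] at hu
  obtain ⟨e, he, hen, hei⟩ := exists_measurePreserving_frame hu0
  set w := √((r + 1) / (3 * r)) with hw
  have hw0 : 0 ≤ w := Real.sqrt_nonneg _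
  set f : ℝ → ℝ := fun b => r + 1 - b ^ 2 / (2 * r + 11 / 6) with hf
  set R := regionBetween f (fun _ => r + 1) (Ioc (-w) w) with hR
  have hfc : Continuous f := by fun_prop
  have hRm : MeasurableSet R :=
    measurableSet_regionBetween hfc.measurable measurable_const measurableSet_Ioc
  have hRv : volume R = ENNReal.ofReal (2 / 3 * w ^ 3 / (2 * r + 11 / 6)) := by
    rw [hR, Measure.volume_eq_prod, volume_regionBetween_eq_integral]
    · congr 1
      rw [← intervalIntegral.integral_of_le (by linarith)]
      simp only [Pi.sub_apply, hf, sub_sub_cancel]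
      rw [intervalIntegral.integral_div, integral_pow]
      norm_num
      ring
    · exact hfc.integrableOn_Icc.mono_set Ioc_subset_Icc_self
    · exact continuous_const.integrableOn_Icc.mono_set Ioc_subset_Icc_self
    · exact measurableSet_Ioc
    · intro b _
      have : 0 ≤ b ^ 2 / (2 * r + 11 / 6) := by positivity
      simp only [hf]; linarith
  have hsub : e ⁻¹' sliver (r + 1) x u ⊆ Prod.swap ⁻¹' R := by
    intro p hp
    obtain ⟨h1, h2, h3⟩ := hp
    rw [hei, hu, mul_one] at h2
    have h4 : ‖e p - x‖ ^ 2 < hexRadius ^ 2 := by gcongr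
    have h5 : (r + 1) ^ 2 < ‖e p‖ ^ 2 := by gcongr
    have h6 : inner ℝ (e p) x = ‖x‖ * p.1 := by
      conv_lhs => rw [hx]
      rw [inner_smul_right, hei, hu, mul_one]
    rw [norm_sub_sq_real, hexRadius_sq, h6, hen] at h4
    rw [hen] at h5
    have h7 : 0 < ‖x‖ := by
      have := norm_le_norm_sub_add (e p) x
      linarith [hexRadius_lt]
    obtain ⟨h8, h9⟩ := sliver_coordinates hr hxr (by linarith) h2 h5 h7
    have h10 : |p.2| < w := by
      rw [hw, Real.lt_sqrt (abs_nonneg _), sq_abs]; exact h8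
    rw [abs_lt] at h10
    exact ⟨⟨h10.1, h10.2.le⟩, h9, h2⟩
  have hle : volume (sliver (r + 1) x u) ≤ ENNReal.ofReal (2 / 3 * w ^ 3 / (2 * r + 11 / 6)) := by
    rw [← he.measure_preimage_equiv, ← hRv]
    refine (measure_mono hsub).trans (le_of_eq ?_)
    exact Measure.measurePreserving_swap.measure_preimage hRm.nullMeasurableSet
  exact ENNReal.toReal_le_of_le_ofReal (by positivity) hle

/-- Points in the annulus `r - 0.16 ≤ ‖x‖ ≤ r` that are `2`-separated are seen from the origin under
angles of at least `2 * 0.99 / r`. -/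
theorem card_boundary_le {r : ℝ} (hr : 1 ≤ r) (B : Finset Plane)
    (hB : ∀ x ∈ B, r - 0.16 ≤ ‖x‖ ∧ ‖x‖ ≤ r)
    (hBB : ∀ x ∈ B, ∀ y ∈ B, x ≠ y → 2 ≤ ‖x - y‖) :
    0.99 * (B.card : ℝ) ≤ Real.pi * r := by
  have hπ := Real.pi_gt_three
  set α := 0.99 / r with hα
  have hα0 : 0 < α := by positivity
  have hα1 : α ≤ 1 := by rw [hα, div_le_one (by linarith)]; linarith
  have h0 : ∀ x ∈ B, x ≠ 0 := fun x hx h => by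
    have := (hB x hx).1; rw [h, norm_zero] at this; linarith
  have hdisj : (B : Set Plane).PairwiseDisjoint fun x => sector 1 α x := by
    intro x hx y hy hxy
    have hx := Finset.mem_coe.1 hx
    have hy := Finset.mem_coe.1 hy
    refine disjoint_sector hα0.le hα0.le (by linarith) ?_ (h0 x hx) (h0 y hy)
    obtain ⟨hx1, hx2⟩ := hB x hx
    obtain ⟨hy1, hy2⟩ := hB y hy
    have h1 := norm_sub_sq_real x y
    have h2 : 4 ≤ ‖x - y‖ ^ 2 := by nlinarith [hBB x hx y hy hxy]
    have h3 : (‖x‖ - ‖y‖) ^ 2 ≤ 0.16 ^ 2 := sq_le_sq' (by linarith) (by linarith)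
    have h4 := Real.one_sub_sq_div_two_le_cos (x := α + α)
    have h5 : 0 ≤ ‖x‖ * ‖y‖ := by positivity
    have h6 : ‖x‖ * ‖y‖ ≤ r * r := by gcongr
    have h7 := mul_le_mul_of_nonneg_right h4 h5
    have h8 : α ^ 2 * (‖x‖ * ‖y‖) ≤ 0.99 ^ 2 := by
      calc α ^ 2 * (‖x‖ * ‖y‖) ≤ α ^ 2 * (r * r) := by gcongr
        _ = 0.99 ^ 2 := by rw [hα]; field_simp
    nlinarith
  have hsum : ∑ x ∈ B, volume.real (sector 1 α x) ≤ Real.pi * 1 ^ 2 := by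
    rw [← measureReal_biUnion_finset hdisj (fun v _ => measurableSet_sector _ _ _)
      (fun v _ => volume_ne_top_of_subset_ball (ρ := 1) fun y hy => hy.1),
      ← volume_real_ball 0 zero_le_one]
    refine measureReal_mono ?_ measure_ball_lt_top.ne
    refine iUnion₂_subset fun v _ y hy => ?_
    simpa using hy.1
  rw [Finset.sum_congr rfl fun x hx => volume_real_sector one_pos hα0 (by linarith) (h0 x hx),
    Finset.sum_const, nsmul_eq_mul, hα] at hsum
  have : (B.card : ℝ) * (1 ^ 2 * (0.99 / r)) * r = 0.99 * B.card := by field_simp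
  nlinarith

/-- The total area of the slivers is smaller than the difference between the areas of the hexagon
circumscribed about the unit circle and of the unit disc. -/
theorem boundary_estimate {r N : ℝ} (hr : 1 ≤ r) (hN : 0.99 * N ≤ Real.pi * r) :
    N * (2 / 3 * √((r + 1) / (3 * r)) ^ 3 / (2 * r + 11 / 6)) ≤ 2 * √3 - Real.pi := by
  have hπ := Real.pi_lt_d4
  have h3 : (1.732 : ℝ) < √3 := by rw [Real.lt_sqrt (by norm_num)]; norm_num
  set w := √((r + 1) / (3 * r)) with hw
  have hw0 : 0 ≤ w := Real.sqrt_nonneg _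
  have hw2 : w ^ 2 = (r + 1) / (3 * r) := Real.sq_sqrt (by positivity)
  -- AM-GM, which is nearly sharp at `r = 1`, makes the bound on `w ^ 3` rational in `r`.
  have hw1 : w ≤ (5 / 4 * w ^ 2 + 4 / 5) / 2 := by nlinarith [sq_nonneg (w - 4 / 5)]
  have hw3 : w ^ 3 ≤ (r + 1) / (3 * r) * ((5 / 4 * ((r + 1) / (3 * r)) + 4 / 5) / 2) := by
    rw [← hw2, pow_succ]; gcongr
  have hN' : N ≤ (1587 / 500) * r := by nlinarith
  calc N * (2 / 3 * w ^ 3 / (2 * r + 11 / 6))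
      ≤ (1587 / 500) * r * (2 / 3 * ((r + 1) / (3 * r) * ((5 / 4 * ((r + 1) / (3 * r)) + 4 / 5) / 2))
        / (2 * r + 11 / 6)) := by gcongr
    _ ≤ (161 / 500) := by
      rw [show (1587 / 500) * r *
        (2 / 3 * ((r + 1) / (3 * r) * ((5 / 4 * ((r + 1) / (3 * r)) + 4 / 5) / 2))
        / (2 * r + 11 / 6)) = (1587 / 500) * (2 / 3) * (r + 1) * (5 / 4 * (r + 1) + 12 / 5 * r)
          / (18 * r * (2 * r + 11 / 6)) by field_simp; ring]
      rw [div_le_iff₀ (by positivity)]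
      nlinarith
    _ ≤ _ := by linarith

/-! ### Counting separated points in a disc -/

theorem exists_unit_direction (x : Plane) : ∃ u : Plane, ‖u‖ = 1 ∧ x = ‖x‖ • u := by
  by_cases hx : x = 0
  · obtain ⟨u, hu⟩ := exists_norm_eq Plane (zero_le_one : (0 : ℝ) ≤ 1)
    exact ⟨u, hu, by simp [hx]⟩
  · have h : ‖x‖ ≠ 0 := norm_ne_zero_iff.2 hx
    exact ⟨‖x‖⁻¹ • x, by simp [norm_smul, h], by rw [smul_smul, mul_inv_cancel₀ h, one_smul]⟩

theorem measurableSet_truncatedCell (V : Finset Plane) : MeasurableSet (truncatedCell V) := by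
  have h₁ : MeasurableSet {y : Plane | ‖y‖ < hexRadius} :=
    measurableSet_lt (by fun_prop) (by fun_prop)
  have h₂ : MeasurableSet (⋂ v ∈ V, {y : Plane | inner ℝ y v < ‖v‖ ^ 2 / 2}) :=
    V.measurableSet_biInter fun v _ => measurableSet_lt (by fun_prop) (by fun_prop)
  convert h₁.inter h₂ using 1
  ext y
  simp [truncatedCell]

/-- The area comparison between the truncated cells and the disc of radius `r + 1`, for unit
hard-core radius. -/
theorem card_mul_le_of_one_le {r : ℝ} (hr : 1 ≤ r) (S : Finset Plane) (hS : ∀ x ∈ S, ‖x‖ ≤ r)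
    (hSS : ∀ x ∈ S, ∀ y ∈ S, x ≠ y → 2 ≤ ‖x - y‖) :
    (S.card : ℝ) * (2 * √3) ≤ Real.pi * (r + 1) ^ 2 + (2 * √3 - Real.pi) := by
  classical
  choose u hu hxu using exists_unit_direction
  -- `x + v x` is the mirror image of `x` in the tangent line of the circle of radius `r + 1`.
  set v : Plane → Plane := fun x => (2 * (r + 1 - ‖x‖)) • u x with hv
  set V : Plane → Finset Plane := fun x => insert (v x) ((S.erase x).image fun z => z - x)
  set T : Plane → Set Plane := fun x => (fun y => y - x) ⁻¹' truncatedCell (V x) with hT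
  have hvn : ∀ x ∈ S, ‖v x‖ = 2 * (r + 1 - ‖x‖) := fun x hx => by
    simp only [hv]
    rw [norm_smul, hu, mul_one, Real.norm_of_nonneg (by linarith [hS x hx])]
  have hvz : ∀ x ∈ S, ∀ z ∈ S, 2 ≤ ‖v x - (z - x)‖ := fun x hx z hz => by
    have h1 : v x + x = (2 * (r + 1) - ‖x‖) • u x := by
      calc v x + x = (2 * (r + 1 - ‖x‖)) • u x + ‖x‖ • u x := by rw [← hxu x]
        _ = _ := by rw [← add_smul]; congr 1; ring
    have h2 : v x - (z - x) = (v x + x) - z := by abel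
    rw [h2, h1]
    have h3 := norm_sub_norm_le ((2 * (r + 1) - ‖x‖) • u x) z
    rw [norm_smul, hu, mul_one, Real.norm_of_nonneg (by linarith [hS x hx])] at h3
    linarith [hS x hx, hS z hz]
  have hTvol : ∀ x ∈ S, 2 * √3 ≤ volume.real (T x) := by
    intro x hx
    have h1 : volume.real (T x) = volume.real (truncatedCell (V x)) := by
      rw [measureReal_def, measureReal_def, (measurePreserving_sub_right volume x).measure_preimage
        (measurableSet_truncatedCell _).nullMeasurableSet]
    rw [h1]
    refine volume_truncatedCell_ge _ ?_ ?_
    · intro w hw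
      rcases Finset.mem_insert.1 hw with rfl | hw
      · rw [hvn x hx]; linarith [hS x hx]
      · obtain ⟨z, hz, rfl⟩ := Finset.mem_image.1 hw
        obtain ⟨hzx, hz⟩ := Finset.mem_erase.1 hz
        exact hSS z hz x hx hzx
    · intro w hw w' hw' hne
      rcases Finset.mem_insert.1 hw with rfl | hw <;> rcases Finset.mem_insert.1 hw' with rfl | hw'
      · exact absurd rfl hne
      · obtain ⟨z, hz, rfl⟩ := Finset.mem_image.1 hw'
        exact hvz x hx z (Finset.mem_of_mem_erase hz)
      · obtain ⟨z, hz, rfl⟩ := Finset.mem_image.1 hw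
        rw [norm_sub_rev]
        exact hvz x hx z (Finset.mem_of_mem_erase hz)
      · obtain ⟨z, hz, rfl⟩ := Finset.mem_image.1 hw
        obtain ⟨z', hz', rfl⟩ := Finset.mem_image.1 hw'
        rw [sub_sub_sub_cancel_right]
        exact hSS z (Finset.mem_of_mem_erase hz) z' (Finset.mem_of_mem_erase hz')
          fun h => hne (by rw [h])
  have hcloser : ∀ x ∈ S, ∀ z ∈ S, z ≠ x → ∀ y ∈ T x, ‖y - x‖ < ‖y - z‖ := by
    intro x _ z hz hzx y hy
    have h1 := hy.2 (z - x)
      (Finset.mem_insert_of_mem (Finset.mem_image_of_mem _ (Finset.mem_erase.2 ⟨hzx, hz⟩)))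
    have h2 := norm_sub_sq_real (y - x) (z - x)
    rw [sub_sub_sub_cancel_right] at h2
    exact lt_of_pow_lt_pow_left₀ 2 (norm_nonneg _) (by linarith)
  have hdisj : (S : Set Plane).PairwiseDisjoint T := by
    intro x hx z hz hxz
    rw [Function.onFun, Set.disjoint_left]
    intro y hyx hyz
    exact lt_asymm (hcloser x hx z hz hxz.symm y hyx) (hcloser z hz x hx hxz y hyz)
  have hcut : ∀ x ∈ S, ∀ y ∈ T x, inner ℝ y (u x) < r + 1 := by
    intro x hx y hy
    have h1 := hy.2 (v x) (Finset.mem_insert_self _ _)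
    have h0 : 0 < r + 1 - ‖x‖ := by linarith [hS x hx]
    have h2 : inner ℝ x (u x) = ‖x‖ := by
      have h := congrArg (fun z => inner ℝ z (u x)) (hxu x)
      simpa only [real_inner_smul_left, real_inner_self_eq_norm_sq, hu, one_pow, mul_one] using h
    rw [hvn x hx, hv] at h1
    simp only [inner_smul_right, inner_sub_left, h2] at h1
    nlinarith
  -- The other points are farther than `hexRadius` from the circle of radius `r + 1`.
  set B := S.filter fun x => r - 0.16 ≤ ‖x‖ with hB
  have hBS : ∀ x ∈ B, x ∈ S := fun x hx => (Finset.mem_filter.1 hx).1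
  have hcover : (⋃ x ∈ S, T x) ⊆
      Metric.closedBall 0 (r + 1) ∪ ⋃ x ∈ B, sliver (r + 1) x (u x) := by
    intro y hy
    obtain ⟨x, hx, hyT⟩ := mem_iUnion₂.1 hy
    by_cases hq : ‖y‖ ≤ r + 1
    · left; simpa using hq
    · right
      push Not at hq
      have h1 : ‖y - x‖ < hexRadius := hyT.1
      have h2 := norm_le_norm_sub_add y x
      have h3 := hexRadius_lt
      refine mem_biUnion (Finset.mem_filter.2 ⟨hx, by linarith⟩) ⟨h1, hcut x hx y hyT, hq⟩
  have hsliver_fin : ∀ x ∈ B, sliver (r + 1) x (u x) ⊆ Metric.ball x hexRadius := by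
    intro x _ y hy
    rw [mem_ball_iff_norm]; exact hy.1
  have hfin : volume (Metric.closedBall (0 : Plane) (r + 1) ∪
      ⋃ x ∈ B, sliver (r + 1) x (u x)) ≠ ⊤ := by
    refine (measure_union_lt_top measure_closedBall_lt_top ?_).ne
    refine (measure_biUnion_lt_top B.finite_toSet fun x hx => ?_)
    exact (measure_mono (hsliver_fin x hx)).trans_lt measure_ball_lt_top
  have hball : volume.real (Metric.closedBall (0 : Plane) (r + 1)) = Real.pi * (r + 1) ^ 2 := by
    rw [← volume_real_ball 0 (by linarith), measureReal_def, measureReal_def,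
      Measure.addHaar_closedBall_eq_addHaar_ball]
  have hmain : (S.card : ℝ) * (2 * √3) ≤ Real.pi * (r + 1) ^ 2 +
      B.card * (2 / 3 * √((r + 1) / (3 * r)) ^ 3 / (2 * r + 11 / 6)) := by
    calc (S.card : ℝ) * (2 * √3) = ∑ x ∈ S, 2 * √3 := by rw [Finset.sum_const, nsmul_eq_mul]
      _ ≤ ∑ x ∈ S, volume.real (T x) := Finset.sum_le_sum hTvol
      _ = volume.real (⋃ x ∈ S, T x) := by
        refine (measureReal_biUnion_finset hdisj
          (fun x _ => (measurableSet_truncatedCell _).preimage (measurable_sub_const x))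
          fun x _ => ?_).symm
        refine ((measure_mono (?_ : T x ⊆ Metric.ball x hexRadius)).trans_lt
          measure_ball_lt_top).ne
        intro y hy
        rw [mem_ball_iff_norm]; exact hy.1
      _ ≤ _ := measureReal_mono hcover hfin
      _ ≤ _ := measureReal_union_le _ _
      _ ≤ _ := by
        rw [hball]
        gcongr
        refine (measureReal_biUnion_finset_le _ _).trans ?_
        rw [← nsmul_eq_mul]
        exact Finset.sum_le_card_nsmul _ _ _ fun x hx =>
          volume_sliver_le hr (hu x) (hxu x) (hS x (hBS x hx))
  have hcard := card_boundary_le hr B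
    (fun x hx => ⟨(Finset.mem_filter.1 hx).2, hS x (hBS x hx)⟩)
    (fun x hx y hy => hSS x (hBS x hx) y (hBS y hy))
  linarith [boundary_estimate hr hcard]

theorem card_mul_le {r : ℝ} (hr : 0 ≤ r) (S : Finset Plane) (hS : ∀ x ∈ S, ‖x‖ ≤ r)
    (hSS : ∀ x ∈ S, ∀ y ∈ S, x ≠ y → 2 ≤ ‖x - y‖) :
    (S.card : ℝ) * (2 * √3) ≤ Real.pi * (r + 1) ^ 2 + (2 * √3 - Real.pi) := by
  rcases le_or_gt 1 r with h | h
  · exact card_mul_le_of_one_le h S hS hSS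
  · have h1 : S.card ≤ 1 := by
      refine Finset.card_le_one.2 fun x hx y hy => ?_
      by_contra hxy
      linarith [hSS x hx y hy hxy, norm_sub_le x y, hS x hx, hS y hy]
    have h2 : (S.card : ℝ) ≤ 1 := by exact_mod_cast h1
    have h3 : 0 ≤ √3 := Real.sqrt_nonneg 3
    nlinarith [Real.pi_pos, mul_nonneg Real.pi_pos.le hr]

/-- The finite form of Thue's theorem: the number of `2H`-separated points in a closed disc of
radius `r`. -/
theorem card_le_of_separated {H : ℝ} (hH : 0 < H) {r : ℝ} (hr : 0 ≤ r) (S : Finset Plane)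
    (hS : ∀ x ∈ S, ‖x‖ ≤ r) (hSS : ∀ x ∈ S, ∀ y ∈ S, x ≠ y → 2 * H ≤ ‖x - y‖) :
    (S.card : ℝ) ≤ 1 + Real.pi / √12 * (2 * r / H + r ^ 2 / H ^ 2) := by
  classical
  have hinj : Function.Injective fun x : Plane => H⁻¹ • x :=
    smul_right_injective Plane (inv_ne_zero hH.ne')
  have h := card_mul_le (r := r / H) (by positivity) (S.image fun x => H⁻¹ • x) ?_ ?_
  · rw [Finset.card_image_of_injective _ hinj] at h
    have h12 : √12 = 2 * √3 := by
      rw [show (12 : ℝ) = 2 ^ 2 * 3 by norm_num, Real.sqrt_mul (by norm_num),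
        Real.sqrt_sq (by norm_num)]
    rw [h12]
    refine le_of_mul_le_mul_right (h.trans (le_of_eq ?_)) (by positivity : 0 < 2 * √3)
    field_simp
    ring
  · intro y hy
    obtain ⟨x, hx, rfl⟩ := Finset.mem_image.1 hy
    rw [norm_smul, norm_inv, Real.norm_of_nonneg hH.le, inv_mul_eq_div]
    gcongr
    exact hS x hx
  · intro y hy y' hy' hne
    obtain ⟨x, hx, rfl⟩ := Finset.mem_image.1 hy
    obtain ⟨x', hx', rfl⟩ := Finset.mem_image.1 hy'
    rw [← smul_sub, norm_smul, norm_inv, Real.norm_of_nonneg hH.le, inv_mul_eq_div,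
      le_div_iff₀ hH]
    exact hSS x hx x' hx' fun h => hne (by rw [h])

/-! ### Summation by parts -/

/-- If at most `G s` points have `f x ≤ s`, for every `s ≥ t`, then the sum of a non-increasing
function `ℓ` over the points is at most the Stieltjes integral of `ℓ` against `G` on `[t, R]`, with
the mass `G t` placed at `t`. -/
theorem sum_antitone_le {ι : Type*} {ℓ G G' : ℝ → ℝ} {t : ℝ} (ht : 0 ≤ t)
    (hℓ_nonneg : ∀ r, 0 ≤ r → 0 ≤ ℓ r) (hℓ_anti : AntitoneOn ℓ (Set.Ici 0))
    (hG : ∀ r, HasDerivAt G (G' r) r) (hG' : Continuous G') (hG'0 : ∀ r, 0 ≤ r → 0 ≤ G' r)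
    (hGt : 0 ≤ G t) (f : ι → ℝ) (F : Finset ι) (hF : ∀ x ∈ F, t ≤ f x)
    (hcard : ∀ s, t ≤ s → ((F.filter fun x => f x ≤ s).card : ℝ) ≤ G s) {R : ℝ} (hR : t ≤ R)
    (hFR : ∀ x ∈ F, f x ≤ R) :
    ∑ x ∈ F, ℓ (f x) ≤ (∫ r in t..R, ℓ r * G' r) + ℓ t * G t := by
  classical
  have hint : ∀ a b, 0 ≤ a → 0 ≤ b → IntervalIntegrable (fun r => ℓ r * G' r) volume a b := by
    intro a b ha hb
    refine IntervalIntegrable.mul_continuousOn ?_ hG'.continuousOn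
    refine (hℓ_anti.mono fun x hx => ?_).intervalIntegrable
    exact (le_min ha hb).trans hx.1
  have hlow : ∀ a b, 0 ≤ a → a ≤ b → ℓ b * (G b - G a) ≤ ∫ r in a..b, ℓ r * G' r := by
    intro a b ha hab
    rw [← intervalIntegral.integral_eq_sub_of_hasDerivAt (fun r _ => hG r)
      (hG'.intervalIntegrable a b), ← intervalIntegral.integral_const_mul]
    refine intervalIntegral.integral_mono_on hab ((hG'.intervalIntegrable a b).const_mul _)
      (hint a b ha (ha.trans hab)) fun r hr => ?_
    have hr0 : 0 ≤ r := ha.trans hr.1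
    exact mul_le_mul_of_nonneg_right (hℓ_anti hr0 (hr0.trans hr.2) hr.2) (hG'0 r hr0)
  -- Keeping the unused mass `G R - card F` at the right end makes the bound inductive: the points are
  -- added in the order of increasing `f`, with `R` taken to be the value at the last one.
  suffices h : ∀ R, t ≤ R → (∀ x ∈ F, f x ≤ R) → ∑ x ∈ F, ℓ (f x) + (G R - F.card) * ℓ R ≤
      (∫ r in t..R, ℓ r * G' r) + ℓ t * G t by
    have h1 := h R hR hFR
    have h2 := hcard R hR
    rw [Finset.filter_true_of_mem hFR] at h2
    nlinarith [mul_nonneg (sub_nonneg.2 h2) (hℓ_nonneg R (ht.trans hR))]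
  clear hFR hR R
  induction F using Finset.induction_on_max_value f with
  | empty =>
    intro R hR _
    have h1 := hlow t R ht hR
    have h2 := mul_le_mul_of_nonneg_right (hℓ_anti ht (ht.trans hR) hR) hGt
    simp only [Finset.sum_empty, Finset.card_empty, Nat.cast_zero]
    linarith
  | insert a s ha hmax ih =>
    intro R hR hsR
    have hta := hF a (Finset.mem_insert_self _ _)
    have haR := hsR a (Finset.mem_insert_self _ _)
    have h1 := ih (fun x hx => hF x (Finset.mem_insert_of_mem hx))
      (fun u hu => le_trans (by gcongr; exact Finset.subset_insert _ _) (hcard u hu))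
      (f a) hta hmax
    have h2 := hcard (f a) hta
    rw [Finset.filter_true_of_mem (fun x hx => by
      rcases Finset.mem_insert.1 hx with rfl | hx
      exacts [le_rfl, hmax x hx])] at h2
    have h3 := hlow (f a) R (ht.trans hta) haR
    have h4 := intervalIntegral.integral_add_adjacent_intervals
      (hint t (f a) ht (ht.trans hta)) (hint (f a) R (ht.trans hta) (ht.trans hR))
    have h5 := mul_le_mul_of_nonneg_left (hℓ_anti (ht.trans hta) (ht.trans hR) haR)
      (sub_nonneg.2 h2)
    rw [Finset.sum_insert ha]
    rw [Finset.card_insert_of_notMem ha] at h5 ⊢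
    push_cast at h5 ⊢
    linarith

/-! ### The interference bound -/

theorem corollary1 {Ω : Type*} [MeasurableSpace Ω] (P : Measure Ω) [IsProbabilityMeasure P]
    (Φ : Ω → Configuration) (hΦ : IsStationaryPointProcess P Φ)
    (H : ℝ) (hH : 0 < H) (hHΦ : IsHardcoreRegulated P H Φ)
    (ℓ : ℝ → ℝ) (hℓ_nonneg : ∀ r, 0 ≤ r → 0 ≤ ℓ r) (hℓ_anti : AntitoneOn ℓ (Set.Ici 0)) :
    ∀ᵐ ω ∂P, ∀ x₀ : Plane, (Φ ω).IsNearest x₀ →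
      ∀ d t : ℝ, d = ‖x₀‖ → t = max d (2 * H - d) →
        ∀ R : ℝ, t ≤ R →
          (Φ ω).interference ℓ x₀ R ≤
            (∫ r in t..R, (2 * Real.pi * ℓ r / Real.sqrt 12) * (1 / H + r / H ^ 2))
              + (Real.pi * ℓ t * t / Real.sqrt 12) * (2 / H + t / H ^ 2) := by
  classical
  filter_upwards [hHΦ] with ω hω x₀ hx₀ d t hd ht R hR
  have hπ := Real.pi_pos
  have hdt : d ≤ t := ht ▸ le_max_left _ _
  have hHdt : 2 * H - d ≤ t := ht ▸ le_max_right _ _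
  have ht0 : 0 ≤ t := le_trans (hd ▸ norm_nonneg x₀) hdt
  set F := ((Φ ω).finite_interferers x₀ R).toFinset with hF
  have hmem : ∀ x ∈ F, x ∈ (Φ ω).carrier ∧ ‖x‖ < R ∧ x ≠ x₀ := by
    intro x hx
    rw [hF, Set.Finite.mem_toFinset] at hx
    exact ⟨hx.1.1, by simpa using hx.1.2, hx.2⟩
  have key := sum_antitone_le (ι := Plane) (ℓ := ℓ)
    (G := fun r => Real.pi / √12 * (2 * r / H + r ^ 2 / H ^ 2))
    (G' := fun r => 2 * Real.pi / √12 * (1 / H + r / H ^ 2)) ht0 hℓ_nonneg hℓ_anti ?_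
    (by fun_prop) (fun r hr => by positivity) (by positivity) (fun x => ‖x‖) F ?_ ?_ hR
    fun x hx => (hmem x hx).2.1.le
  · calc (Φ ω).interference ℓ x₀ R
        ≤ (∫ r in t..R, ℓ r * (2 * Real.pi / √12 * (1 / H + r / H ^ 2))) +
          ℓ t * (Real.pi / √12 * (2 * t / H + t ^ 2 / H ^ 2)) := key
      _ = _ := by
        congr 1
        · refine intervalIntegral.integral_congr fun r _ => ?_
          ring
        · ring
  · intro r
    have h1 : HasDerivAt (fun r : ℝ => 2 * r / H + r ^ 2 / H ^ 2) (2 * 1 / H + 2 * r / H ^ 2) r := by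
      refine HasDerivAt.add (((hasDerivAt_id r).const_mul 2).div_const H) ?_
      simpa using (hasDerivAt_pow 2 r).div_const (H ^ 2)
    exact (h1.const_mul (Real.pi / √12)).congr_deriv (by ring)
  · intro x hx
    obtain ⟨hxΦ, -, hne⟩ := hmem x hx
    rw [ht, max_le_iff]
    refine ⟨hd ▸ hx₀.2 x hxΦ, ?_⟩
    have := hω x hxΦ x₀ hx₀.1 hne
    linarith [norm_sub_le x x₀]
  · intro s hs
    have hx₀F : x₀ ∉ F.filter fun x => ‖x‖ ≤ s := fun h =>
      (hmem x₀ (Finset.mem_filter.1 h).1).2.2 rfl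
    have hcar : ∀ x ∈ insert x₀ (F.filter fun x => ‖x‖ ≤ s), x ∈ (Φ ω).carrier := by
      intro x hx
      rcases Finset.mem_insert.1 hx with rfl | hx
      · exact hx₀.1
      · exact (hmem x (Finset.mem_filter.1 hx).1).1
    -- Adding `x₀` itself uses up the constant `1` in the counting bound.
    have h := card_le_of_separated hH (ht0.trans hs) (insert x₀ (F.filter fun x => ‖x‖ ≤ s)) ?_
      fun x hx y hy => hω x (hcar x hx) y (hcar y hy)
    · rw [Finset.card_insert_of_notMem hx₀F] at h
      push_cast at h
      linarith
    · intro x hx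
      rcases Finset.mem_insert.1 hx with rfl | hx
      · linarith
      · exact (Finset.mem_filter.1 hx).2
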